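/- Let $(\Omega,\mathcal F,\mathbb P)$ be a probability space, let $\sigma_1,\sigma_2>0$ and $\rho\in(-1,1)$ be constants, and let $B_1,B_2$ be standard Brownian motions on $[0,1]$ with correlation $\rho$, that is, $B_2=\rho B_1+\sqrt{1-\rho^2}\,B_3$ with $B_3$ a standard Brownian motion on $[0,1]$ independent of $B_1$. Let $X=(X_1,X_2)$ satisfy, almost surely for all $t\in[0,1]$ and for $\ell=1,2$, $$X_{\ell,t}=X_{\ell,0}+\sigma_\ell B_{\ell,t}+\int_0^t b_\ell(s,\omega)\,ds ,$$ where the drifts are bounded: $b_1,b_2\in L^\infty([0,1]\times\Omega,\,dt\otimes\mathbb P)$. For $n\ge1$ and $1\le k\le n$ put $\Delta^n_kX_\ell=X_{\ell,k/n}-X_{\ell,(k-1)/n}$, and let $$\beta^n_{\ell,1}(X)=\frac{\sum_{k=1}^n \Delta^n_kX_1\,\Delta^n_kX_2}{\sum_{k=1}^n(\Delta^n_kX_\ell)^2}$$ be the realized regression coefficient (with the convention $\beta^n_{\ell,1}(X)=0$ if the denominator vanishes). Then, for $\ell,\iota\in\{1,2\}$ with $\ell\neq\iota$, the sequence $(\beta^n_{\ell,1}(X))_{n\ge1}$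 satisfies the large deviation principle on $\mathbb R$ with speed $n$ and with the good rate function $$I(u)=\frac12\log\left(1+\frac{(\sigma_\ell u-\rho\sigma_\iota)^2}{\sigma_\iota^2(1-\rho^2)}\right),\qquad u\in\mathbb R .$$ That is, $I$ is lower semicontinuous with compact sublevel sets, and for every Borel set $A\subset\mathbb R$, $$-\inf_{u\in A^\circ}I(u)\le\liminf_{n\to\infty}\frac1n\log\mathbb P\big(\beta^n_{\ell,1}(X)\in A\big)\le\limsup_{n\to\infty}\frac1n\log\mathbb P\big(\beta^n_{\ell,1}(X)\in A\big)\le-\inf_{u\in\overline A}I(u).$$ -/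

import Mathlib

open MeasureTheory ProbabilityTheory Filter Set
open scoped ENNReal NNReal Topology

noncomputable section

/-- `B` restricted to the time interval `[0,1]` is a standard Brownian motion under `P`: it starts
at `0`, has independent increments with `B t - B s` of law `N(0, t - s)`, and almost surely
continuous paths. (The values of `B` outside `[0,1]` are irrelevant.) -/
structure IsStdBrownianOnUnit {Ω : Type*} [MeasurableSpace Ω] (P : Measure Ω)
    (B : ℝ → Ω → ℝ) : Prop where
  zero : ∀ᵐ ω ∂P, B 0 ω = 0
  indep_increments : HasIndepIncrements (fun (t : Icc (0 : ℝ) 1) ω => B t ω) P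
  law_increment : ∀ s t : ℝ, 0 ≤ s → s ≤ t → t ≤ 1 →
    HasLaw (fun ω => B t ω - B s ω) (gaussianReal 0 (t - s).toNNReal) P
  continuous_paths : ∀ᵐ ω ∂P, ContinuousOn (fun t => B t ω) (Icc 0 1)

/-- `B 0, B 1` are standard Brownian motions on `[0,1]` with constant correlation `ρ`:
`B 1 = ρ B 0 + √(1 - ρ²) W`, where `W` is a standard Brownian motion on `[0,1]`
independent of `B 0`. -/
def IsCorrelatedBrownianPair {Ω : Type*} [MeasurableSpace Ω] (P : Measure Ω) (ρ : ℝ)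
    (B : Fin 2 → ℝ → Ω → ℝ) : Prop :=
  IsStdBrownianOnUnit P (B 0) ∧
  ∃ W : ℝ → Ω → ℝ, IsStdBrownianOnUnit P W ∧
    IndepFun (fun ω (t : Icc (0 : ℝ) 1) => B 0 t ω) (fun ω (t : Icc (0 : ℝ) 1) => W t ω) P ∧
    ∀ᵐ ω ∂P, ∀ t ∈ Icc (0 : ℝ) 1, B 1 t ω = ρ * B 0 t ω + √(1 - ρ ^ 2) * W t ω

/-- The drift is essentially bounded: `b ∈ L^∞([0,1] × Ω, dt ⊗ P)`. -/
def IsBoundedDrift {Ω : Type*} [MeasurableSpace Ω] (P : Measure Ω) (b : ℝ → Ω → ℝ) : Prop :=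
  MemLp (fun p : ℝ × Ω => b p.1 p.2) ∞ ((volume.restrict (Icc (0 : ℝ) 1)).prod P)

/-- `dX_t = σ dB_t + b(t, ω) dt` on `[0,1]` with constant `σ`, in integral form:
almost surely, `X_t = X_0 + σ (B_t - B_0) + ∫_0^t b(s, ω) ds` for all `t ∈ [0,1]`. -/
def IsConstVolItoProcess {Ω : Type*} [MeasurableSpace Ω] (P : Measure Ω) (σ : ℝ)
    (B b X : ℝ → Ω → ℝ) : Prop :=
  ∀ᵐ ω ∂P, ∀ t ∈ Icc (0 : ℝ) 1,
    X t ω = X 0 ω + σ * (B t ω - B 0 ω) + ∫ s in (0 : ℝ)..t, b s ω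

/-- The increment `Z_{k/n} - Z_{(k-1)/n}`. -/
def gridIncrement {Ω : Type*} (Z : ℝ → Ω → ℝ) (n k : ℕ) (ω : Ω) : ℝ :=
  Z ((k : ℝ) / n) ω - Z (((k : ℝ) - 1) / n) ω

/-- Realized variance `∑_{k=1}^{⌊nt⌋} (Δ_k Z)²`. -/
def realizedVariance {Ω : Type*} (Z : ℝ → Ω → ℝ) (n : ℕ) (t : ℝ) (ω : Ω) : ℝ :=
  ∑ k ∈ Finset.Icc 1 ⌊(n : ℝ) * t⌋₊, gridIncrement Z n k ω ^ 2

/-- Realized covariance `∑_{k=1}^{⌊nt⌋} (Δ_k X_1)(Δ_k X_2)`. -/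
def realizedCovariance {Ω : Type*} (X : Fin 2 → ℝ → Ω → ℝ) (n : ℕ) (t : ℝ) (ω : Ω) : ℝ :=
  ∑ k ∈ Finset.Icc 1 ⌊(n : ℝ) * t⌋₊, gridIncrement (X 0) n k ω * gridIncrement (X 1) n k ω

/-- Realized regression coefficient: realized covariance over the realized variance of `X ℓ`. -/
def realizedRegression {Ω : Type*} (X : Fin 2 → ℝ → Ω → ℝ) (ℓ : Fin 2) (n : ℕ) (t : ℝ)
    (ω : Ω) : ℝ :=
  realizedCovariance X n t ω / realizedVariance (X ℓ) n t ω

/-- A rate function: a lower semicontinuous `[0,∞]`-valued function. It is good if, in addition,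
its sublevel sets are compact. -/
structure IsGoodRateFunction {S : Type*} [TopologicalSpace S] (I : S → ℝ≥0∞) : Prop where
  lowerSemicontinuous : LowerSemicontinuous I
  isCompact_sublevel : ∀ c : ℝ≥0, IsCompact {x | I x ≤ c}

/-- The random variables `M n` satisfy the large deviation principle with speed `r n → ∞` and rate
function `I`. Here `ENNReal.log 0 = ⊥` and the infimum over the empty set is `⊤`. -/
structure SatisfiesLDP {Ω S : Type*} [MeasurableSpace Ω] [TopologicalSpace S] [MeasurableSpace S]
    (P : Measure Ω) (M : ℕ → Ω → S) (r : ℕ → ℝ) (I : S → ℝ≥0∞) : Prop where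
  aemeasurable : ∀ n, AEMeasurable (M n) P
  speed_tendsto : Tendsto r atTop atTop
  lowerSemicontinuous : LowerSemicontinuous I
  lower_bound : ∀ A : Set S, MeasurableSet A →
    -(⨅ x ∈ interior A, (I x : EReal)) ≤
      liminf (fun n => (((r n)⁻¹ : ℝ) : EReal) * ENNReal.log (P {ω | M n ω ∈ A})) atTop
  upper_bound : ∀ A : Set S, MeasurableSet A →
    limsup (fun n => (((r n)⁻¹ : ℝ) : EReal) * ENNReal.log (P {ω | M n ω ∈ A})) atTop ≤
      -(⨅ x ∈ closure A, (I x : EReal))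

end

/-! Without drift, the increments scaled by `√n` are `n` independent copies of a Gaussian pair.
After normalisation the regressor is `ξ` and the other coordinate is `ρ ξ + √(1 - ρ²) η`, with `ξ`,
`η` independent standard normal. Up to an affine change of variable, the question is whether the
regression coefficient of `η` on `ξ` is near, or beyond, a level `c`. This is read off the sign and
size of `∑ ξ (η - c ξ)`, so Laplace transforms of quadratic forms suffice: `E exp (½ (u ξ² + 2 v ξ η
+ w η²)) = ((1 - u)(1 - w) - v²)^(-1/2)`. For the form `λ ξ (η - c ξ)` the determinant is `1 + 2cλ -
λ²`, which is largest at `λ = c`, with value `1 + c²`. This is where the rate `½ log (1 + c²)` comes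
from.

Upper bound (`measure_regression_ge_le`): exponential Chebyshev with the tilt `λ = c`. Lower bound
(`le_measure_quadratic_window`): under the tilted law `c` is the true regression coefficient, and
the relevant sums concentrate at their means. No change of measure is carried out: the total mass
`(1 + c²)^(-n/2)` of the tilted weight is split over a window and its complement, and the complement
is bounded by slightly different tilts whose masses are exponentially smaller.

A bounded drift adds `O(1/n)` to each increment, hence `O(n^(-1/2))` after scaling, so the sum of
the squared errors is bounded uniformly in `n`. By Young's inequality this changes `∑ ξ (η - c ξ)`
by at most `δ ∑ (ξ² + η²)` plus a constant. The first term is a small change of the quadratic form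
and the second is invisible at speed `n`; thus neither Girsanov's theorem nor adaptedness of the
drift is needed.

The rate is unimodal, so half lines (from above) and small intervals (from below) give the full
principle (`SatisfiesLDP.of_halfLine_of_near`). -/

/-! ### Gaussian integrals of exponentials of quadratic forms -/

/-- Completing the square: the integrand times the standard normal density is a multiple of the
normal density with mean `t / (1 - w)` and variance `1 / (1 - w)`. -/
lemma lintegral_exp_quadratic_gaussianReal {w : ℝ} (hw : w < 1) (t : ℝ) :
    ∫⁻ y, ENNReal.ofReal (Real.exp (1 / 2 * w * y ^ 2 + t * y)) ∂(gaussianReal 0 1) =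
      ENNReal.ofReal ((√(1 - w))⁻¹ * Real.exp (t ^ 2 / (2 * (1 - w)))) := by
  have h1 : 0 < 1 - w := by linarith
  have hv : ((1 - w)⁻¹).toNNReal ≠ 0 := (Real.toNNReal_pos.2 (inv_pos.2 h1)).ne'
  rw [gaussianReal_of_var_ne_zero _ one_ne_zero,
    lintegral_withDensity_eq_lintegral_mul _ (measurable_gaussianPDF _ _) (by fun_prop)]
  rw [← mul_one (ENNReal.ofReal _),
    ← lintegral_gaussianPDF_eq_one (t / (1 - w)) hv,
    ← lintegral_const_mul _ (measurable_gaussianPDF _ _)]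
  congr 1 with y
  simp only [Pi.mul_apply, gaussianPDF]
  rw [← ENNReal.ofReal_mul (gaussianPDFReal_nonneg _ _ _), ← ENNReal.ofReal_mul (by positivity)]
  congr 1
  simp only [gaussianPDFReal, NNReal.coe_one, Real.coe_toNNReal _ (inv_pos.2 h1).le, mul_one, sub_zero]
  have h2 : √(2 * Real.pi * (1 - w)⁻¹) = √(2 * Real.pi) * (√(1 - w))⁻¹ := by
    rw [Real.sqrt_mul (by positivity), Real.sqrt_inv]
  have h3 : 0 < √(1 - w) := Real.sqrt_pos.2 h1
  have h4 : Real.exp (t ^ 2 / (2 * (1 - w))) *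
      Real.exp (-(y - t / (1 - w)) ^ 2 / (2 * (1 - w)⁻¹)) =
      Real.exp (-y ^ 2 / 2) * Real.exp (1 / 2 * w * y ^ 2 + t * y) := by
    rw [← Real.exp_add, ← Real.exp_add]
    congr 1
    field_simp
    ring
  rw [h2, mul_inv, inv_inv]
  calc (√(2 * Real.pi))⁻¹ * Real.exp (-y ^ 2 / 2) * Real.exp (1 / 2 * w * y ^ 2 + t * y)
      = (√(2 * Real.pi))⁻¹ *
        (Real.exp (-y ^ 2 / 2) * Real.exp (1 / 2 * w * y ^ 2 + t * y)) := by ring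
    _ = _ := by rw [← h4]; field_simp

/-- Half of the quadratic form with matrix `(u, v; v, w)`. -/
noncomputable def halfQuadratic (u v w x y : ℝ) : ℝ := 1 / 2 * (u * x ^ 2 + 2 * v * (x * y) + w * y ^ 2)

@[fun_prop]
lemma measurable_halfQuadratic (u v w : ℝ) :
    Measurable fun p : ℝ × ℝ => halfQuadratic u v w p.1 p.2 := by
  unfold halfQuadratic; fun_prop

lemma lintegral_exp_halfQuadratic {u v w : ℝ} (hw : w < 1) (hd : v ^ 2 < (1 - u) * (1 - w)) :
    ∫⁻ x, ∫⁻ y, ENNReal.ofReal (Real.exp (halfQuadratic u v w x y))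
      ∂(gaussianReal 0 1) ∂(gaussianReal 0 1) =
      ENNReal.ofReal (√((1 - u) * (1 - w) - v ^ 2))⁻¹ := by
  have h1 : 0 < 1 - w := by linarith
  have inner : ∀ x : ℝ, ∫⁻ y, ENNReal.ofReal (Real.exp (halfQuadratic u v w x y))
      ∂(gaussianReal 0 1) = ENNReal.ofReal (√(1 - w))⁻¹ *
        ENNReal.ofReal (Real.exp (1 / 2 * (u + v ^ 2 / (1 - w)) * x ^ 2 + 0 * x)) := by
    intro x
    have e : ∀ y : ℝ, ENNReal.ofReal (Real.exp (halfQuadratic u v w x y)) =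
        ENNReal.ofReal (Real.exp (1 / 2 * u * x ^ 2)) *
          ENNReal.ofReal (Real.exp (1 / 2 * w * y ^ 2 + (v * x) * y)) := by
      intro y
      rw [← ENNReal.ofReal_mul (Real.exp_pos _).le, ← Real.exp_add]
      congr 2
      unfold halfQuadratic
      ring
    simp_rw [e]
    rw [lintegral_const_mul _ (by fun_prop), lintegral_exp_quadratic_gaussianReal hw,
      ← ENNReal.ofReal_mul (Real.exp_pos _).le, ← ENNReal.ofReal_mul (by positivity)]
    congr 1
    rw [mul_left_comm, ← Real.exp_add]
    congr 2
    field_simp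
    ring
  have h2 : u + v ^ 2 / (1 - w) < 1 := by
    have : v ^ 2 / (1 - w) < 1 - u := by rwa [div_lt_iff₀ h1]
    linarith
  simp_rw [inner]
  rw [lintegral_const_mul _ (by fun_prop), lintegral_exp_quadratic_gaussianReal h2,
    ← ENNReal.ofReal_mul (by positivity)]
  congr 1
  have h3 : (1 - u) * (1 - w) - v ^ 2 = (1 - w) * (1 - (u + v ^ 2 / (1 - w))) := by
    field_simp
    ring
  rw [h3, Real.sqrt_mul h1.le]
  simp [mul_comm]

lemma lintegral_pi_prod_comp {n : ℕ} (μ : Measure ℝ) [IsProbabilityMeasure μ]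
    {f : Fin n → ℝ → ℝ≥0∞} (hf : ∀ i, Measurable (f i)) :
    ∫⁻ x, ∏ i, f i (x i) ∂(Measure.pi fun _ : Fin n => μ) = ∏ i, ∫⁻ x, f i x ∂μ := by
  have hind : iIndepFun (fun i (x : Fin n → ℝ) => f i (x i)) (Measure.pi fun _ : Fin n => μ) :=
    iIndepFun_pi (fun i => (hf i).aemeasurable)
  rw [lintegral_prod_eq_prod_lintegral_of_indepFun _ _ hind
    (fun i => (hf i).comp (measurable_pi_apply i))]
  refine Finset.prod_congr rfl fun i _ => ?_
  exact (measurePreserving_eval (fun _ : Fin n => μ) i).lintegral_comp (hf i)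

/-! ### Laplace transforms of sums of quadratic forms -/

/-- The pairs `(ξ i, η i)` have the Laplace transforms of quadratic forms which independent pairs
of independent standard normal random variables have. -/
structure HasQuadraticLaplace {Ω : Type*} [MeasurableSpace Ω] (P : Measure Ω) {n : ℕ}
    (ξ η : Fin n → Ω → ℝ) : Prop where
  aemeasurable_left : ∀ i, AEMeasurable (ξ i) P
  aemeasurable_right : ∀ i, AEMeasurable (η i) P
  lintegral_eq : ∀ u v w : ℝ, w < 1 → v ^ 2 < (1 - u) * (1 - w) →
    ∫⁻ ω, ENNReal.ofReal (Real.exp (∑ i, halfQuadratic u v w (ξ i ω) (η i ω))) ∂P =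
      ENNReal.ofReal (√((1 - u) * (1 - w) - v ^ 2))⁻¹ ^ n

lemma HasQuadraticLaplace.of_indepFun {Ω : Type*} [MeasurableSpace Ω] {P : Measure Ω}
    [IsProbabilityMeasure P] {n : ℕ} {ξ η : Fin n → Ω → ℝ}
    (hξ : ∀ i, HasLaw (ξ i) (gaussianReal 0 1) P) (hη : ∀ i, HasLaw (η i) (gaussianReal 0 1) P)
    (hiξ : iIndepFun ξ P) (hiη : iIndepFun η P)
    (hξη : IndepFun (fun ω i => ξ i ω) (fun ω i => η i ω) P) :
    HasQuadraticLaplace P ξ η where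
  aemeasurable_left i := (hξ i).aemeasurable
  aemeasurable_right i := (hη i).aemeasurable
  lintegral_eq u v w hw hd := by
    have h1 : HasLaw (fun ω => (fun i => ξ i ω, fun i => η i ω))
        ((Measure.pi fun _ : Fin n => gaussianReal 0 1).prod
          (Measure.pi fun _ : Fin n => gaussianReal 0 1)) P :=
      (indepFun_iff_hasLaw_prodMk_prod (hiξ.hasLaw_pi hξ) (hiη.hasLaw_pi hη)).1 hξη
    have h2 := h1.lintegral_comp (f := fun p : (Fin n → ℝ) × (Fin n → ℝ) =>
      ∏ i, ENNReal.ofReal (Real.exp (halfQuadratic u v w (p.1 i) (p.2 i))))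
      (by unfold halfQuadratic; fun_prop)
    simp_rw [Real.exp_sum, ENNReal.ofReal_prod_of_nonneg (fun _ _ => (Real.exp_pos _).le)]
    rw [h2, lintegral_prod _ (by unfold halfQuadratic; fun_prop)]
    simp only
    have h3 : ∀ x : Fin n → ℝ, ∫⁻ y, ∏ i, ENNReal.ofReal (Real.exp (halfQuadratic u v w (x i) (y i)))
        ∂(Measure.pi fun _ : Fin n => gaussianReal 0 1) =
        ∏ i, ∫⁻ y, ENNReal.ofReal (Real.exp (halfQuadratic u v w (x i) y)) ∂(gaussianReal 0 1) :=
      fun x => lintegral_pi_prod_comp (gaussianReal 0 1)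
        (f := fun i y => ENNReal.ofReal (Real.exp (halfQuadratic u v w (x i) y)))
        (fun i => by unfold halfQuadratic; fun_prop)
    simp_rw [h3]
    rw [lintegral_pi_prod_comp (gaussianReal 0 1)
      (f := fun _ x => ∫⁻ y, ENNReal.ofReal (Real.exp (halfQuadratic u v w x y)) ∂(gaussianReal 0 1))
      (fun i => Measurable.lintegral_prod_right' (f := fun p : ℝ × ℝ =>
        ENNReal.ofReal (Real.exp (halfQuadratic u v w p.1 p.2))) (by fun_prop))]
    simp [lintegral_exp_halfQuadratic hw hd]

/-- The orthogonal matrix `(p, q; q, -p)` conjugates the form and preserves the determinant of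
identity minus form, so the invariance is pure algebra. It exchanges the roles of regressor and
response in a correlated pair. -/
lemma HasQuadraticLaplace.reflect {Ω : Type*} [MeasurableSpace Ω] {P : Measure Ω}
    {n : ℕ} {ξ η : Fin n → Ω → ℝ} (h : HasQuadraticLaplace P ξ η) {p q : ℝ}
    (hpq : p ^ 2 + q ^ 2 = 1) :
    HasQuadraticLaplace P (fun i ω => p * ξ i ω + q * η i ω) (fun i ω => q * ξ i ω - p * η i ω) where
  aemeasurable_left i := ((h.1 i).const_mul _).add ((h.2 i).const_mul _)
  aemeasurable_right i := ((h.1 i).const_mul _).sub ((h.2 i).const_mul _)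
  lintegral_eq u v w hw hd := by
    have e : ∀ x y : ℝ, halfQuadratic u v w (p * x + q * y) (q * x - p * y) =
        halfQuadratic (p ^ 2 * u + 2 * p * q * v + q ^ 2 * w)
          (p * q * u + (q ^ 2 - p ^ 2) * v - p * q * w)
          (q ^ 2 * u - 2 * p * q * v + p ^ 2 * w) x y := by
      intro x y; unfold halfQuadratic; ring
    have hd' : (1 - (p ^ 2 * u + 2 * p * q * v + q ^ 2 * w)) *
        (1 - (q ^ 2 * u - 2 * p * q * v + p ^ 2 * w)) -
        (p * q * u + (q ^ 2 - p ^ 2) * v - p * q * w) ^ 2 = (1 - u) * (1 - w) - v ^ 2 := by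
      linear_combination (-u - w + (p ^ 2 + q ^ 2 + 1) * (u * w - v ^ 2)) * hpq
    have hw' : q ^ 2 * u - 2 * p * q * v + p ^ 2 * w < 1 := by
      have h1 : 0 < 1 - w := by linarith
      have h2 : 0 < (1 - w) * (1 - (q ^ 2 * u - 2 * p * q * v + p ^ 2 * w)) := by
        -- The second factor is the positive definite form of identity minus `(u, v; v, w)` at the
        -- vector `(q, -p)`; multiplying by `1 - w` completes the square.
        have h3 : (1 - w) * (1 - (q ^ 2 * u - 2 * p * q * v + p ^ 2 * w)) =
            q ^ 2 * ((1 - u) * (1 - w) - v ^ 2) + (p * (1 - w) + q * v) ^ 2 := by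
          linear_combination -(1 - w) * hpq
        rw [h3]
        rcases eq_or_ne q 0 with hq | hq
        · subst hq
          have : p ≠ 0 := by rintro rfl; norm_num at hpq
          simp only [zero_mul, add_zero]
          positivity
        · have : 0 < q ^ 2 := by positivity
          have : 0 < (1 - u) * (1 - w) - v ^ 2 := by linarith
          positivity
      have := (mul_pos_iff_of_pos_left h1).1 h2
      linarith
    simp_rw [e]
    rw [h.3 _ _ _ hw' (by linarith), hd']

lemma HasQuadraticLaplace.aemeasurable_exp {Ω : Type*} [MeasurableSpace Ω] {P : Measure Ω}
    {n : ℕ} {ξ η : Fin n → Ω → ℝ} (h : HasQuadraticLaplace P ξ η) (u v w : ℝ) :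
    AEMeasurable
      (fun ω => ENNReal.ofReal (Real.exp (∑ i, halfQuadratic u v w (ξ i ω) (η i ω)))) P := by
  have h1 : ∀ i, AEMeasurable (fun ω => halfQuadratic u v w (ξ i ω) (η i ω)) P := by
    intro i
    have hξ := h.aemeasurable_left i
    have hη := h.aemeasurable_right i
    unfold halfQuadratic
    fun_prop
  have h2 : AEMeasurable (fun ω => ∑ i, halfQuadratic u v w (ξ i ω) (η i ω)) P :=
    Finset.aemeasurable_fun_sum _ fun i _ => h1 i
  exact h2.exp.ennreal_ofReal

/-- Exponential Chebyshev inequality for quadratic forms. -/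
lemma HasQuadraticLaplace.measure_le {Ω : Type*} [MeasurableSpace Ω] {P : Measure Ω}
    {n : ℕ} {ξ η : Fin n → Ω → ℝ} (h : HasQuadraticLaplace P ξ η) {u v w : ℝ} (hw : w < 1)
    (hd : v ^ 2 < (1 - u) * (1 - w)) {S : Set Ω} {C : ℝ}
    (hS : ∀ᵐ ω ∂P, ω ∈ S → 0 ≤ C + ∑ i, halfQuadratic u v w (ξ i ω) (η i ω)) :
    P S ≤ ENNReal.ofReal (Real.exp C * (√((1 - u) * (1 - w) - v ^ 2))⁻¹ ^ n) := by
  rw [ENNReal.ofReal_mul (Real.exp_pos _).le, ENNReal.ofReal_pow (by positivity),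
    ← h.lintegral_eq u v w hw hd, ← lintegral_const_mul'' _ (h.aemeasurable_exp u v w)]
  set g := fun ω => ENNReal.ofReal (Real.exp C) *
    ENNReal.ofReal (Real.exp (∑ i, halfQuadratic u v w (ξ i ω) (η i ω))) with hg
  calc P S ≤ P {ω | 1 ≤ g ω} := by
        refine measure_mono_ae ?_
        filter_upwards [hS] with ω hω hmem
        change 1 ≤ g ω
        rw [hg]
        simp only
        rw [← ENNReal.ofReal_mul (Real.exp_pos _).le, ← Real.exp_add, ENNReal.one_le_ofReal,
          Real.one_le_exp_iff]
        exact hω hmem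
    _ ≤ ∫⁻ ω, g ω ∂P := by
        have := mul_meas_ge_le_lintegral₀ ((h.aemeasurable_exp u v w).const_mul
          (ENNReal.ofReal (Real.exp C))) 1
        rwa [one_mul] at this

/-! ### Stability under perturbation and the upper bound -/

/-- Young's inequality with weight `δ` on the terms mixing `x`, `y` with the errors; terms quadratic
in the errors go into `C`. The `δ` part will be absorbed into the quadratic form, the `C` part stays
bounded after summation. -/
lemma exists_abs_mul_sub_le (c : ℝ) {δ : ℝ} (hδ : 0 < δ) :
    ∃ C : ℝ, 0 ≤ C ∧ ∀ x y a b : ℝ, |a * (b - c * a) - x * (y - c * x)| ≤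
      δ * (x ^ 2 + y ^ 2) + C * ((a - x) ^ 2 + (b - y) ^ 2) := by
  refine ⟨1 / δ + 1 + 2 * c ^ 2 / δ + |c|, by positivity, fun x y a b => ?_⟩
  obtain ⟨e, rfl⟩ : ∃ e, a = x + e := ⟨a - x, by ring⟩
  obtain ⟨f, rfl⟩ : ∃ f, b = y + f := ⟨b - y, by ring⟩
  have amgm : ∀ s t : ℝ, |s * t| ≤ δ / 2 * s ^ 2 + 1 / (2 * δ) * t ^ 2 := by
    intro s t
    have h1 : δ / 2 * s ^ 2 + 1 / (2 * δ) * t ^ 2 - |s| * |t| =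
        1 / (2 * δ) * (δ * |s| - |t|) ^ 2 := by
      rw [← sq_abs s, ← sq_abs t]
      field_simp
      ring
    have h2 : 0 ≤ 1 / (2 * δ) * (δ * |s| - |t|) ^ 2 := by positivity
    rw [abs_mul]
    linarith
  have h1 := amgm x f
  have h2 := amgm y e
  have h3 := amgm x (2 * c * e)
  have h4 : |e * f| ≤ e ^ 2 + f ^ 2 := by
    rw [abs_le]; constructor <;> nlinarith [sq_nonneg (e + f), sq_nonneg (e - f)]
  have h5 : |c * e ^ 2| = |c| * e ^ 2 := by rw [abs_mul, abs_of_nonneg (sq_nonneg e)]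
  have h6 : (x + e) * (y + f - c * (x + e)) - x * (y - c * x) =
      x * f + y * e - x * (2 * c * e) + e * f - c * e ^ 2 := by ring
  have h7 : |x * f + y * e - x * (2 * c * e) + e * f - c * e ^ 2| ≤
      |x * f| + |y * e| + |x * (2 * c * e)| + |e * f| + |c * e ^ 2| := by
    refine (abs_sub _ _).trans (add_le_add_left ?_ _)
    refine (abs_add_le _ _).trans (add_le_add_left ?_ _)
    refine (abs_sub _ _).trans (add_le_add_left ?_ _)
    exact abs_add_le _ _
  rw [h6]
  refine h7.trans ?_
  rw [h5]
  have h8 : 1 / (2 * δ) * (2 * c * e) ^ 2 = 2 * c ^ 2 / δ * e ^ 2 := by field_simp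
  have h9 : 0 ≤ 2 * c ^ 2 / δ * f ^ 2 := by positivity
  have h10 : 0 ≤ |c| * f ^ 2 := by positivity
  have h11 : 0 ≤ 1 / (2 * δ) * f ^ 2 := by positivity
  have h12 : 0 ≤ 1 / (2 * δ) * e ^ 2 := by positivity
  have h13 : 0 ≤ δ / 2 * y ^ 2 := by positivity
  have h14 : 1 / δ = 2 * (1 / (2 * δ)) := by field_simp
  rw [h14]
  simp only [add_sub_cancel_left]
  nlinarith

lemma sum_abs_mul_sub_le {n : ℕ} {c δ C K : ℝ} (hC : 0 ≤ C)
    (h : ∀ x y a b : ℝ, |a * (b - c * a) - x * (y - c * x)| ≤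
      δ * (x ^ 2 + y ^ 2) + C * ((a - x) ^ 2 + (b - y) ^ 2))
    (x y a b : Fin n → ℝ) (hK : ∑ i, ((a i - x i) ^ 2 + (b i - y i) ^ 2) ≤ K) :
    |∑ i, a i * (b i - c * a i) - ∑ i, x i * (y i - c * x i)| ≤
      δ * ∑ i, (x i ^ 2 + y i ^ 2) + C * K := by
  rw [← Finset.sum_sub_distrib]
  calc |∑ i, (a i * (b i - c * a i) - x i * (y i - c * x i))|
      ≤ ∑ i, |a i * (b i - c * a i) - x i * (y i - c * x i)| := Finset.abs_sum_le_sum_abs _ _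
    _ ≤ ∑ i, (δ * (x i ^ 2 + y i ^ 2) + C * ((a i - x i) ^ 2 + (b i - y i) ^ 2)) :=
        Finset.sum_le_sum fun i _ => h _ _ _ _
    _ = δ * ∑ i, (x i ^ 2 + y i ^ 2) + C * ∑ i, ((a i - x i) ^ 2 + (b i - y i) ^ 2) := by
        rw [Finset.sum_add_distrib, Finset.mul_sum, Finset.mul_sum]
    _ ≤ _ := by gcongr

lemma inv_sqrt_pow_eq_exp {d : ℝ} (hd : 0 < d) (n : ℕ) :
    (√d)⁻¹ ^ n = Real.exp (-n * (1 / 2 * Real.log d)) := by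
  have h : (√d)⁻¹ = Real.exp (-(1 / 2 * Real.log d)) := by
    rw [Real.exp_neg, ← Real.exp_log (Real.sqrt_pos.2 hd), Real.log_sqrt hd.le]
    congr 2
    ring
  rw [h, ← Real.exp_nat_mul]
  congr 1
  ring

/-- Upper large deviation bound for a regression coefficient to exceed the level `c` in the
direction of the sign of `c`, robust under perturbations of bounded square sum. -/
lemma measure_regression_ge_le (c K : ℝ) {ε : ℝ} (hε : 0 < ε) :
    ∃ N : ℕ, ∀ n ≥ N, ∀ {Ω : Type*} [MeasurableSpace Ω] {P : Measure Ω}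
      {ξ η a b : Fin n → Ω → ℝ}, HasQuadraticLaplace P ξ η →
      (∀ᵐ ω ∂P, ∑ i, ((a i ω - ξ i ω) ^ 2 + (b i ω - η i ω) ^ 2) ≤ K) →
      P {ω | 0 ≤ c * ∑ i, a i ω * (b i ω - c * a i ω)} ≤
        ENNReal.ofReal (Real.exp (-n * (1 / 2 * Real.log (1 + c ^ 2) - ε))) := by
  -- The determinant for the form `c x (y - c x) + |c| δ (x² + y²)`, the optimal tilt plus the
  -- perturbation error. By continuity at `0`, a small `δ` costs at most `ε / 2` of the rate.
  set D : ℝ → ℝ := fun δ => (1 - (-2 * c ^ 2 + 2 * (|c| * δ))) * (1 - 2 * (|c| * δ)) - c ^ 2 with hD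
  have hDc : Continuous D := by rw [hD]; fun_prop
  have hD0 : D 0 = 1 + c ^ 2 := by simp [hD]; ring
  have hpos : 0 < D 0 := by rw [hD0]; positivity
  obtain ⟨δ, hδ, h1, h2, h3⟩ : ∃ δ > 0, 0 < D δ ∧ 2 * (|c| * δ) < 1 ∧
      1 / 2 * Real.log (1 + c ^ 2) - ε / 2 < 1 / 2 * Real.log (D δ) := by
    have e1 : ∀ᶠ δ in 𝓝 (0 : ℝ), 0 < D δ := hDc.continuousAt.eventually (lt_mem_nhds hpos)
    have e2 : ∀ᶠ δ in 𝓝 (0 : ℝ), 2 * (|c| * δ) < 1 :=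
      (by fun_prop : Continuous fun δ : ℝ => 2 * (|c| * δ)).continuousAt.eventually
        (gt_mem_nhds (by simp))
    have e3 : ∀ᶠ δ in 𝓝 (0 : ℝ), 1 / 2 * Real.log (1 + c ^ 2) - ε / 2 < 1 / 2 * Real.log (D δ) :=
      ((hDc.continuousAt.log hpos.ne').const_mul _).eventually
        (lt_mem_nhds (by simp only [hD0]; linarith))
    have e4 : ∀ᶠ δ in 𝓝[>] (0 : ℝ), δ ∈ Ioi (0 : ℝ) := self_mem_nhdsWithin
    obtain ⟨δ, ⟨⟨g1, g2⟩, g3⟩, g4⟩ :=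
      ((((e1.and e2).and e3).filter_mono nhdsWithin_le_nhds).and e4).exists
    exact ⟨δ, g4, g1, g2, g3⟩
  obtain ⟨C, hC, hCb⟩ := exists_abs_mul_sub_le c hδ
  -- The other `ε / 2` pays for the constant factor `exp (|c| C K)`.
  obtain ⟨N, hN⟩ := exists_nat_ge (|c| * (C * K) / (ε / 2))
  refine ⟨N, fun n hn Ω _ P ξ η a b hξη hK => ?_⟩
  refine (hξη.measure_le (u := -2 * c ^ 2 + 2 * (|c| * δ)) (v := c) (w := 2 * (|c| * δ)) h2
    (by linarith [h1]) (C := |c| * (C * K)) ?_).trans ?_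
  · filter_upwards [hK] with ω hω hmem
    have h4 := sum_abs_mul_sub_le hC hCb (fun i => ξ i ω) (fun i => η i ω) (fun i => a i ω)
      (fun i => b i ω) hω
    have h5 : ∑ i, halfQuadratic (-2 * c ^ 2 + 2 * (|c| * δ)) c (2 * (|c| * δ)) (ξ i ω) (η i ω) =
        c * ∑ i, ξ i ω * (η i ω - c * ξ i ω) + |c| * (δ * ∑ i, (ξ i ω ^ 2 + η i ω ^ 2)) := by
      rw [Finset.mul_sum, Finset.mul_sum, Finset.mul_sum, ← Finset.sum_add_distrib]
      refine Finset.sum_congr rfl fun i _ => ?_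
      unfold halfQuadratic
      ring
    rw [h5]
    have h6 := (le_abs_self _).trans_eq (abs_mul c
      (∑ i, a i ω * (b i ω - c * a i ω) - ∑ i, ξ i ω * (η i ω - c * ξ i ω)))
    have h7 := mul_le_mul_of_nonneg_left h4 (abs_nonneg c)
    have h8 : 0 ≤ c * ∑ i, a i ω * (b i ω - c * a i ω) := hmem
    linarith
  · refine ENNReal.ofReal_le_ofReal ?_
    rw [inv_sqrt_pow_eq_exp h1, ← Real.exp_add, Real.exp_le_exp]
    have h9 : |c| * (C * K) ≤ n * (ε / 2) := by
      rw [div_le_iff₀ (by positivity)] at hN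
      exact hN.trans (by gcongr)
    have h10 : (n : ℝ) * (1 / 2 * Real.log (1 + c ^ 2) - ε / 2) ≤ n * (1 / 2 * Real.log (D δ)) := by
      gcongr
    linarith

/-! ### The lower bound by tilting -/

/-- If off the set `A` one of finitely many exponentially tilted bounds holds, then the Laplace
transform is controlled by `P A` and the Laplace transforms of the tilted forms. -/
lemma HasQuadraticLaplace.ofReal_pow_le {Ω : Type*} [MeasurableSpace Ω] {P : Measure Ω}
    {n : ℕ} {ξ η : Fin n → Ω → ℝ} (h : HasQuadraticLaplace P ξ η) {u v w : ℝ} (hw : w < 1)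
    (hd : v ^ 2 < (1 - u) * (1 - w)) {J : Type*} [Fintype J] {u' v' w' s : J → ℝ}
    (hw' : ∀ j, w' j < 1) (hd' : ∀ j, v' j ^ 2 < (1 - u' j) * (1 - w' j)) {A : Set Ω} {t : ℝ}
    (hA : ∀ ω ∈ A, ∑ i, halfQuadratic u v w (ξ i ω) (η i ω) ≤ n * t)
    (hAc : ∀ ω ∉ A, ∃ j, ∑ i, halfQuadratic u v w (ξ i ω) (η i ω) ≤
      n * s j + ∑ i, halfQuadratic (u' j) (v' j) (w' j) (ξ i ω) (η i ω)) :
    ENNReal.ofReal ((√((1 - u) * (1 - w) - v ^ 2))⁻¹ ^ n) ≤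
      ENNReal.ofReal (Real.exp (n * t)) * P A + ENNReal.ofReal (∑ j,
        (Real.exp (s j) * (√((1 - u' j) * (1 - w' j) - v' j ^ 2))⁻¹) ^ n) := by
  set F := fun j ω => ENNReal.ofReal (Real.exp (n * s j)) *
    ENNReal.ofReal (Real.exp (∑ i, halfQuadratic (u' j) (v' j) (w' j) (ξ i ω) (η i ω))) with hF
  have hFm : ∀ j, AEMeasurable (F j) P := fun j => (h.aemeasurable_exp _ _ _).const_mul _
  have hint : ∀ j, ∫⁻ ω, F j ω ∂P = ENNReal.ofReal
      ((Real.exp (s j) * (√((1 - u' j) * (1 - w' j) - v' j ^ 2))⁻¹) ^ n) := by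
    intro j
    rw [hF]
    simp only
    rw [lintegral_const_mul'' _ (h.aemeasurable_exp _ _ _), h.lintegral_eq _ _ _ (hw' j) (hd' j),
      mul_pow, ← Real.exp_nat_mul, ENNReal.ofReal_mul (Real.exp_pos _).le,
      ENNReal.ofReal_pow (by positivity)]
  rw [ENNReal.ofReal_pow (by positivity), ← h.lintegral_eq u v w hw hd,
    ENNReal.ofReal_sum_of_nonneg (fun _ _ => by positivity)]
  simp_rw [← hint]
  calc ∫⁻ ω, ENNReal.ofReal (Real.exp (∑ i, halfQuadratic u v w (ξ i ω) (η i ω))) ∂P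
      ≤ ∫⁻ ω, A.indicator (fun _ => ENNReal.ofReal (Real.exp (n * t))) ω + ∑ j, F j ω ∂P := by
        refine lintegral_mono fun ω => ?_
        by_cases hω : ω ∈ A
        · rw [indicator_of_mem hω]
          refine le_add_right (ENNReal.ofReal_le_ofReal ?_)
          exact Real.exp_le_exp.2 (hA ω hω)
        · obtain ⟨j, hj⟩ := hAc ω hω
          refine le_add_left (le_trans ?_ (Finset.single_le_sum (f := fun j => F j ω)
            (fun _ _ => zero_le) (Finset.mem_univ j)))
          rw [hF]
          simp only
          rw [← ENNReal.ofReal_mul (Real.exp_pos _).le, ← Real.exp_add]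
          exact ENNReal.ofReal_le_ofReal (Real.exp_le_exp.2 hj)
    _ = ∫⁻ ω, A.indicator (fun _ => ENNReal.ofReal (Real.exp (n * t))) ω ∂P +
          ∑ j, ∫⁻ ω, F j ω ∂P := by
        rw [lintegral_add_right' _ (Finset.aemeasurable_fun_sum _ fun j _ => hFm j),
          lintegral_finsetSum' _ fun j _ => hFm j]
    _ ≤ _ := by
        gcongr
        exact lintegral_indicator_const_le _ _

/-- Reduces the comparison of exponential growth rates to an inequality between determinants. -/
lemma exp_mul_inv_sqrt_lt {s d d' : ℝ} (hd : 0 < d) (hd' : 0 < d')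
    (h : Real.exp (2 * s) * d < d') : Real.exp s * (√d')⁻¹ < (√d)⁻¹ := by
  have h1 : Real.exp s * √d < √d' := by
    refine Real.lt_sqrt_of_sq_lt ?_
    rw [mul_pow, Real.sq_sqrt hd.le, ← Real.exp_nat_mul]
    exact_mod_cast h
  have h2 := Real.sqrt_pos.2 hd
  have h3 := Real.sqrt_pos.2 hd'
  rw [← div_eq_mul_inv, ← one_div, div_lt_div_iff₀ h3 h2]
  linarith

/-- The sums of `ξ² + η²`, `ξ²` and `ξ (η - c ξ)` stay close to their means under the Gaussian law
for which `c` is the regression coefficient; the cost of this is the rate function. -/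
lemma le_measure_quadratic_window (c : ℝ) {ε δ : ℝ} (hε : 0 < ε) (hδ : 0 < δ) :
    ∃ N : ℕ, ∀ n ≥ N, ∀ {Ω : Type*} [MeasurableSpace Ω] {P : Measure Ω}
      {ξ η : Fin n → Ω → ℝ}, HasQuadraticLaplace P ξ η →
      ENNReal.ofReal (Real.exp (-n * (1 / 2 * Real.log (1 + c ^ 2) + ε))) ≤
        P {ω | |∑ i, ξ i ω * (η i ω - c * ξ i ω)| < n * δ ∧
          ∑ i, (ξ i ω ^ 2 + η i ω ^ 2) < n * 8 ∧ n * (1 / (2 * (1 + c ^ 2))) < ∑ i, ξ i ω ^ 2} := by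
  have hc : 0 < 1 + c ^ 2 := by positivity
  -- On a window of width `θ` the tilted weight is at most `exp (n |c| θ)`, which may cost only `ε /
  -- 2`; `θ ≤ 1 / 2` is for `hexpθ`.
  obtain ⟨θ, hθ, hθδ, hθ2, hθc⟩ : ∃ θ > 0, θ ≤ δ ∧ θ ≤ 1 / 2 ∧ |c| * θ ≤ ε / 2 := by
    refine ⟨min δ (min (1 / 2) (ε / 2 / (|c| + 1))), by positivity, min_le_left _ _,
      (min_le_right _ _).trans (min_le_left _ _), ?_⟩
    calc |c| * min δ (min (1 / 2) (ε / 2 / (|c| + 1)))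
        ≤ (|c| + 1) * (ε / 2 / (|c| + 1)) := by
          gcongr
          · linarith
          · exact (min_le_right _ _).trans (min_le_right _ _)
      _ = ε / 2 := by field_simp
  -- One tilt for each way of leaving the window. To `c ∑ ξ (η - c ξ)` is added `± θ ∑ ξ (η - c ξ)`,
  -- `(1/8) ∑ (ξ² + η²)` or `-(1 + c²) ∑ ξ²`; `n * s j` compensates at the edge of the window. Under
  -- the tilted law the means of `ξ (η - c ξ)`, `ξ² + η²`, `ξ²` are `0`, `2`, `1 / (1 + c²)`, so the
  -- bounds `8` and `1 / (2 (1 + c²))` leave room. The determinants are `1 + c² - θ²` (twice), `9/16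
  -- + c²/2` and `3 (1 + c²)`.
  set u' : Fin 4 → ℝ :=
    ![-2 * c ^ 2 - 2 * θ * c, -2 * c ^ 2 + 2 * θ * c, -2 * c ^ 2 + 1 / 4,
      -2 * c ^ 2 - 2 * (1 + c ^ 2)] with hu'
  set v' : Fin 4 → ℝ := ![c + θ, c - θ, c, c] with hv'
  set w' : Fin 4 → ℝ := ![0, 0, 1 / 4, 0] with hw'
  set s : Fin 4 → ℝ := ![-θ * θ, -θ * θ, -1, 1 / 2] with hs
  have hexpθ : Real.exp (2 * (-θ * θ)) * (1 + c ^ 2) < 1 + c ^ 2 - θ ^ 2 := by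
    have h1 : 1 + 2 * θ ^ 2 ≤ Real.exp (2 * θ ^ 2) := by
      linarith [Real.add_one_le_exp (2 * θ ^ 2)]
    have h2 : 2 * (-θ * θ) = -(2 * θ ^ 2) := by ring
    rw [h2, Real.exp_neg, inv_mul_lt_iff₀ (Real.exp_pos _)]
    have h3 : 0 < 1 + c ^ 2 - θ ^ 2 := by nlinarith [sq_nonneg c]
    refine lt_of_lt_of_le ?_ (mul_le_mul_of_nonneg_right h1 h3.le)
    have h4 : 0 < θ ^ 2 := by positivity
    have h5 : θ ^ 2 ≤ 1 / 4 := by nlinarith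
    nlinarith [mul_nonneg h4.le (sq_nonneg c)]
  have hlt : ∀ j, Real.exp (2 * s j) * (1 + c ^ 2) < (1 - u' j) * (1 - w' j) - v' j ^ 2 := by
    intro j
    fin_cases j
    · simp only [hs, hu', hv', hw']
      refine (hexpθ.trans_eq ?_)
      simp
      ring
    · simp only [hs, hu', hv', hw']
      refine (hexpθ.trans_eq ?_)
      simp
      ring
    · have h1 : Real.exp (2 * (-1)) ≤ 1 / 2 := by
        rw [mul_neg, Real.exp_neg, mul_one, one_div]
        exact inv_anti₀ (by norm_num) (by linarith [Real.add_one_le_exp (2 : ℝ)])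
      have h2 := mul_le_mul_of_nonneg_right h1 hc.le
      simp [hs, hu', hv', hw'] at h2 ⊢
      linarith
    · have h1 : Real.exp (2 * (1 / 2)) < 3 := by
        rw [mul_one_div_cancel (by norm_num)]
        linarith [Real.exp_one_lt_d9]
      have h2 := mul_lt_mul_of_pos_right h1 hc
      simp [hs, hu', hv', hw'] at h2 ⊢
      linarith
  have hd' : ∀ j, 0 < (1 - u' j) * (1 - w' j) - v' j ^ 2 := fun j =>
    lt_trans (by positivity) (hlt j)
  have hw1 : ∀ j, w' j < 1 := by
    intro j
    fin_cases j <;> norm_num [hw']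
  set Z := (√(1 + c ^ 2))⁻¹ with hZ
  have hZpos : 0 < Z := by positivity
  set q : Fin 4 → ℝ := fun j => Real.exp (s j) * (√((1 - u' j) * (1 - w' j) - v' j ^ 2))⁻¹ with hq
  have hqZ : ∀ j, q j < Z := fun j => exp_mul_inv_sqrt_lt hc (hd' j) (hlt j)
  -- Four exits of relative mass at most `1/8` leave the window at least half of the tilted mass.
  have hev : ∀ᶠ n : ℕ in atTop, ∀ j, (q j / Z) ^ n < 1 / 8 := by
    rw [eventually_all]
    intro j
    have hq0 : 0 ≤ q j := by positivity
    exact (tendsto_pow_atTop_nhds_zero_of_lt_one (by positivity)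
      ((div_lt_one hZpos).2 (hqZ j))).eventually (gt_mem_nhds (by norm_num))
  obtain ⟨N₁, hN₁⟩ := eventually_atTop.1 hev
  obtain ⟨N₂, hN₂⟩ := exists_nat_ge (Real.log 2 / (ε / 2))
  refine ⟨max N₁ N₂, fun n hn Ω _ P ξ η h => ?_⟩
  set A : Set Ω := {ω | |∑ i, ξ i ω * (η i ω - c * ξ i ω)| < n * θ ∧
    ∑ i, (ξ i ω ^ 2 + η i ω ^ 2) < n * 8 ∧ n * (1 / (2 * (1 + c ^ 2))) < ∑ i, ξ i ω ^ 2} with hA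
  -- Dictionary between coefficients of the form and multipliers of the three sums that define the
  -- window.
  have key : ∀ (u v w : ℝ) (ω : Ω) (α β γ : ℝ), u = -2 * c * α + 2 * β + 2 * γ → v = α →
      w = 2 * β → ∑ i, halfQuadratic u v w (ξ i ω) (η i ω) =
      α * ∑ i, ξ i ω * (η i ω - c * ξ i ω) + β * ∑ i, (ξ i ω ^ 2 + η i ω ^ 2) +
        γ * ∑ i, ξ i ω ^ 2 := by
    intro u v w ω α β γ hu hv hw
    rw [Finset.mul_sum, Finset.mul_sum, Finset.mul_sum, ← Finset.sum_add_distrib,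
      ← Finset.sum_add_distrib]
    refine Finset.sum_congr rfl fun i _ => ?_
    unfold halfQuadratic
    rw [hu, hv, hw]
    ring
  have hmain := h.ofReal_pow_le (u := -2 * c ^ 2) (v := c) (w := 0) (by norm_num)
    (by nlinarith [sq_nonneg c]) (A := A) (t := |c| * θ) (s := s) hw1
    (fun j => sub_pos.1 (hd' j)) ?_ ?_
  · have hZ' : (√((1 - -2 * c ^ 2) * (1 - 0) - c ^ 2))⁻¹ = Z := by
      rw [hZ]
      congr 2
      ring
    rw [hZ'] at hmain
    have hsum : ∑ j, q j ^ n ≤ 1 / 2 * Z ^ n := by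
      have : ∀ j, q j ^ n ≤ 1 / 8 * Z ^ n := by
        intro j
        have h1 := (hN₁ n (le_of_max_le_left hn) j).le
        rwa [div_pow, div_le_iff₀ (by positivity)] at h1
      refine (Finset.sum_le_sum fun j _ => this j).trans_eq ?_
      simp
      ring
    have hhalf : ENNReal.ofReal (1 / 2 * Z ^ n) ≤ ENNReal.ofReal (Real.exp (n * (|c| * θ))) * P A := by
      have h1 : ENNReal.ofReal (Z ^ n) =
          ENNReal.ofReal (1 / 2 * Z ^ n) + ENNReal.ofReal (1 / 2 * Z ^ n) := by
        rw [← ENNReal.ofReal_add (by positivity) (by positivity)]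
        congr 1
        ring
      have h2 := hmain.trans (add_le_add_right (ENNReal.ofReal_le_ofReal hsum) _)
      rw [h1] at h2
      exact (ENNReal.add_le_add_iff_right ENNReal.ofReal_ne_top).1 h2
    have hlog : Real.log 2 ≤ n * (ε / 2) := by
      rw [div_le_iff₀ (by positivity)] at hN₂
      refine hN₂.trans ?_
      have : (N₂ : ℝ) ≤ n := by exact_mod_cast le_of_max_le_right hn
      gcongr
    calc ENNReal.ofReal (Real.exp (-n * (1 / 2 * Real.log (1 + c ^ 2) + ε)))
        ≤ ENNReal.ofReal (Real.exp (-(n * (|c| * θ))) * (1 / 2 * Z ^ n)) := by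
          refine ENNReal.ofReal_le_ofReal ?_
          have h2 : (1 / 2 : ℝ) = Real.exp (-Real.log 2) := by
            rw [Real.exp_neg, Real.exp_log (by norm_num), one_div]
          rw [hZ, inv_sqrt_pow_eq_exp hc]
          nth_rw 2 [h2]
          rw [← Real.exp_add, ← Real.exp_add, Real.exp_le_exp]
          have h3 : (n : ℝ) * (|c| * θ) ≤ n * (ε / 2) := by gcongr
          linarith
      _ ≤ ENNReal.ofReal (Real.exp (-(n * (|c| * θ)))) *
            (ENNReal.ofReal (Real.exp (n * (|c| * θ))) * P A) := by
          rw [ENNReal.ofReal_mul (Real.exp_pos _).le]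
          gcongr
      _ = P A := by
          rw [← mul_assoc, ← ENNReal.ofReal_mul (Real.exp_pos _).le, ← Real.exp_add]
          simp
      _ ≤ _ := by
          refine measure_mono fun ω hω => ⟨hω.1.trans_le ?_, hω.2⟩
          gcongr
  · intro ω hω
    rw [key _ _ _ ω c 0 0 (by ring) rfl (by ring)]
    have h1 := (le_abs_self _).trans_eq (abs_mul c (∑ i, ξ i ω * (η i ω - c * ξ i ω)))
    have h2 := mul_le_mul_of_nonneg_left hω.1.le (abs_nonneg c)
    linarith
  · intro ω hω
    rw [key _ _ _ ω c 0 0 (by ring) rfl (by ring)]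
    by_cases h1 : |∑ i, ξ i ω * (η i ω - c * ξ i ω)| < n * θ
    · by_cases h2 : ∑ i, (ξ i ω ^ 2 + η i ω ^ 2) < n * 8
      · have h3 : ∑ i, ξ i ω ^ 2 ≤ n * (1 / (2 * (1 + c ^ 2))) :=
          not_lt.1 fun h3 => hω ⟨h1, h2, h3⟩
        refine ⟨3, ?_⟩
        rw [key _ _ _ ω c 0 (-(1 + c ^ 2)) (by simp [hu']; ring) (by simp [hv']) (by simp [hw'])]
        have h4 := mul_le_mul_of_nonneg_left h3 hc.le
        have h5 : (1 + c ^ 2) * (n * (1 / (2 * (1 + c ^ 2)))) = n * (1 / 2) := by field_simp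
        have h6 : s 3 = 1 / 2 := by simp [hs]
        rw [h6]
        linarith
      · refine ⟨2, ?_⟩
        rw [key _ _ _ ω c (1 / 8) 0 (by simp [hu']; ring) (by simp [hv'])
          (by simp [hw']; norm_num)]
        have h6 : s 2 = -1 := by simp [hs]
        rw [h6]
        linarith
    · rw [not_lt, le_abs] at h1
      rcases h1 with h1 | h1
      · refine ⟨0, ?_⟩
        rw [key _ _ _ ω (c + θ) 0 0 (by simp [hu']; ring) (by simp [hv']) (by simp [hw'])]
        have h6 : s 0 = -θ * θ := by simp [hs]
        rw [h6]
        nlinarith [mul_le_mul_of_nonneg_left h1 hθ.le]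
      · refine ⟨1, ?_⟩
        rw [key _ _ _ ω (c - θ) 0 0 (by simp [hu']; ring) (by simp [hv']) (by simp [hw'])]
        have h6 : s 1 = -θ * θ := by simp [hs]
        rw [h6]
        nlinarith [mul_le_mul_of_nonneg_left h1 hθ.le]

/-- Lower large deviation bound for a regression coefficient to be close to `c`, robust under
perturbations of bounded square sum. -/
lemma le_measure_regression_near (c K : ℝ) {ε δ : ℝ} (hε : 0 < ε) (hδ : 0 < δ) :
    ∃ N : ℕ, ∀ n ≥ N, ∀ {Ω : Type*} [MeasurableSpace Ω] {P : Measure Ω}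
      {ξ η a b : Fin n → Ω → ℝ}, HasQuadraticLaplace P ξ η →
      (∀ᵐ ω ∂P, ∑ i, ((a i ω - ξ i ω) ^ 2 + (b i ω - η i ω) ^ 2) ≤ K) →
      ENNReal.ofReal (Real.exp (-n * (1 / 2 * Real.log (1 + c ^ 2) + ε))) ≤
        P {ω | 0 < ∑ i, a i ω ^ 2 ∧
          |∑ i, a i ω * (b i ω - c * a i ω)| < δ * ∑ i, a i ω ^ 2} := by
  -- The window gives `∑ ξ² > n κ`, hence `∑ a² > n κ / 4` once `K ≤ n κ / 4`. Window width,
  -- perturbation term `8 n · δ κ / 128` and `C K` contribute at most `n δ κ / 16` each; their sum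
  -- stays below `n δ κ / 4 < δ ∑ a²`.
  set κ : ℝ := 1 / (2 * (1 + c ^ 2)) with hκ
  have hκ0 : 0 < κ := by positivity
  obtain ⟨N₁, hN₁⟩ := le_measure_quadratic_window c hε (δ := δ * κ / 16) (by positivity)
  obtain ⟨C, hC, hCb⟩ := exists_abs_mul_sub_le c (δ := δ * κ / 128) (by positivity)
  obtain ⟨N₂, hN₂⟩ := exists_nat_ge (C * K / (δ * κ / 16))
  obtain ⟨N₃, hN₃⟩ := exists_nat_ge (K / (κ / 4))
  refine ⟨max N₁ (max N₂ (max N₃ 1)), fun n hn Ω _ P ξ η a b h hK => ?_⟩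
  refine (hN₁ n (le_of_max_le_left hn) h).trans (measure_mono_ae ?_)
  filter_upwards [hK] with ω hω hmem
  obtain ⟨h1, h2, h3⟩ := hmem
  have hn2 : (N₂ : ℝ) ≤ n := by exact_mod_cast le_of_max_le_left (le_of_max_le_right hn)
  have hn3 : (N₃ : ℝ) ≤ n := by
    exact_mod_cast le_of_max_le_left (le_of_max_le_right (le_of_max_le_right hn))
  have hn1 : (1 : ℝ) ≤ n := by
    exact_mod_cast le_of_max_le_right (le_of_max_le_right (le_of_max_le_right hn))
  have hCK : C * K ≤ n * (δ * κ / 16) := by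
    rw [div_le_iff₀ (by positivity)] at hN₂
    exact hN₂.trans (by gcongr)
  have hKκ : K ≤ n * (κ / 4) := by
    rw [div_le_iff₀ (by positivity)] at hN₃
    exact hN₃.trans (by gcongr)
  have h4 : ∑ i, ξ i ω ^ 2 ≤ 2 * ∑ i, a i ω ^ 2 +
      2 * ∑ i, ((a i ω - ξ i ω) ^ 2 + (b i ω - η i ω) ^ 2) := by
    rw [Finset.mul_sum, Finset.mul_sum, ← Finset.sum_add_distrib]
    refine Finset.sum_le_sum fun i _ => ?_
    nlinarith [sq_nonneg (2 * a i ω - ξ i ω), sq_nonneg (b i ω - η i ω)]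
  have h5 : n * (κ / 4) < ∑ i, a i ω ^ 2 := by linarith
  have h6 := sum_abs_mul_sub_le hC hCb (fun i => ξ i ω) (fun i => η i ω) (fun i => a i ω)
    (fun i => b i ω) hω
  have h7 := abs_sub_abs_le_abs_sub (∑ i, a i ω * (b i ω - c * a i ω))
    (∑ i, ξ i ω * (η i ω - c * ξ i ω))
  have h8 := mul_le_mul_of_nonneg_left h2.le (by positivity : 0 ≤ δ * κ / 128)
  have h9 := mul_lt_mul_of_pos_left h5 hδ
  have h10 : 0 < n * (κ / 4) := by positivity
  exact ⟨h10.trans h5, by linarith [mul_pos hδ h10]⟩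

/-! ### The rate function and the principle from half lines and intervals -/

lemma inv_mul_log_le {n : ℕ} (hn : 0 < n) {p : ℝ≥0∞} {g : ℝ}
    (h : p ≤ ENNReal.ofReal (Real.exp (-n * g))) :
    (((n : ℝ)⁻¹ : ℝ) : EReal) * ENNReal.log p ≤ ((-g : ℝ) : EReal) := by
  have hn' : (0 : ℝ) < n := by exact_mod_cast hn
  have h1 := ENNReal.log_le_log h
  rw [ENNReal.log_ofReal_of_pos (Real.exp_pos _), Real.log_exp] at h1
  refine (mul_le_mul_of_nonneg_left h1 (by exact_mod_cast (inv_pos.2 hn').le)).trans_eq ?_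
  rw [← EReal.coe_mul]
  congr 1
  field_simp

lemma le_inv_mul_log {n : ℕ} (hn : 0 < n) {p : ℝ≥0∞} {g : ℝ}
    (h : ENNReal.ofReal (Real.exp (-n * g)) ≤ p) :
    ((-g : ℝ) : EReal) ≤ (((n : ℝ)⁻¹ : ℝ) : EReal) * ENNReal.log p := by
  have hn' : (0 : ℝ) < n := by exact_mod_cast hn
  have h1 := ENNReal.log_le_log h
  rw [ENNReal.log_ofReal_of_pos (Real.exp_pos _), Real.log_exp] at h1
  refine le_trans (le_of_eq ?_)
    (mul_le_mul_of_nonneg_left h1 (by exact_mod_cast (inv_pos.2 hn').le))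
  rw [← EReal.coe_mul]
  congr 1
  field_simp

lemma half_log_one_add_sq_nonneg (c : ℝ) : 0 ≤ 1 / 2 * Real.log (1 + c ^ 2) :=
  mul_nonneg (by norm_num) (Real.log_nonneg (by nlinarith [sq_nonneg c]))

lemma coe_ofReal_half_log (c : ℝ) :
    ((ENNReal.ofReal (1 / 2 * Real.log (1 + c ^ 2)) : ℝ≥0∞) : EReal) =
      ((1 / 2 * Real.log (1 + c ^ 2) : ℝ) : EReal) := by
  rw [EReal.coe_ennreal_ofReal, max_eq_left (half_log_one_add_sq_nonneg c)]

lemma half_log_one_add_sq_le_iff {c γ : ℝ} (hγ : 0 ≤ γ) :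
    1 / 2 * Real.log (1 + c ^ 2) ≤ γ ↔ |c| ≤ √(Real.exp (2 * γ) - 1) := by
  have h1 : 0 ≤ Real.exp (2 * γ) - 1 := by
    have := Real.one_le_exp (x := 2 * γ) (by linarith)
    linarith
  rw [← Real.sqrt_sq_eq_abs, Real.sqrt_le_sqrt_iff h1, le_sub_iff_add_le',
    ← Real.log_le_iff_le_exp (by positivity)]
  constructor <;> intro h <;> linarith

lemma continuous_regressionRate (x₀ κ : ℝ) :
    Continuous fun x : ℝ => ENNReal.ofReal (1 / 2 * Real.log (1 + ((x - x₀) / κ) ^ 2)) := by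
  refine ENNReal.continuous_ofReal.comp (continuous_const.mul (Continuous.log (by fun_prop) ?_))
  intro x
  positivity

lemma isGoodRateFunction_regressionRate (x₀ : ℝ) {κ : ℝ} (hκ : 0 < κ) :
    IsGoodRateFunction
      fun x : ℝ => ENNReal.ofReal (1 / 2 * Real.log (1 + ((x - x₀) / κ) ^ 2)) where
  lowerSemicontinuous := (continuous_regressionRate x₀ κ).lowerSemicontinuous
  isCompact_sublevel c := by
    refine (isCompact_Icc (a := x₀ - κ * √(Real.exp (2 * c) - 1))
      (b := x₀ + κ * √(Real.exp (2 * c) - 1))).of_isClosed_subset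
      (isClosed_le (continuous_regressionRate x₀ κ) continuous_const) fun x hx => ?_
    have h1 : 1 / 2 * Real.log (1 + ((x - x₀) / κ) ^ 2) ≤ c := by
      have := ENNReal.toReal_mono ENNReal.coe_ne_top hx
      rwa [ENNReal.toReal_ofReal (half_log_one_add_sq_nonneg _)] at this
    have h2 := (half_log_one_add_sq_le_iff c.coe_nonneg).1 h1
    rw [abs_div, abs_of_pos hκ, div_le_iff₀ hκ, abs_le] at h2
    constructor <;> linarith [h2.1, h2.2]

/-- A large deviation principle on the line for a unimodal rate function follows from the upper
bound on half lines away from the minimum and the lower bound on small intervals. -/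
lemma SatisfiesLDP.of_halfLine_of_near {Ω : Type*} [MeasurableSpace Ω] {P : Measure Ω}
    [IsProbabilityMeasure P] {M : ℕ → Ω → ℝ} (hM : ∀ n, AEMeasurable (M n) P) (x₀ : ℝ) {κ : ℝ}
    (hκ : 0 < κ)
    (upper : ∀ c ε : ℝ, 0 < ε → ∀ᶠ n : ℕ in atTop, P {ω | 0 ≤ c * (M n ω - (x₀ + κ * c))} ≤
      ENNReal.ofReal (Real.exp (-n * (1 / 2 * Real.log (1 + c ^ 2) - ε))))
    (lower : ∀ c ε δ : ℝ, 0 < ε → 0 < δ → ∀ᶠ n : ℕ in atTop,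
      ENNReal.ofReal (Real.exp (-n * (1 / 2 * Real.log (1 + c ^ 2) + ε))) ≤
        P {ω | |M n ω - (x₀ + κ * c)| < δ}) :
    SatisfiesLDP P M (fun n => (n : ℝ))
      fun x : ℝ => ENNReal.ofReal (1 / 2 * Real.log (1 + ((x - x₀) / κ) ^ 2)) where
  aemeasurable := hM
  speed_tendsto := tendsto_natCast_atTop_atTop
  lowerSemicontinuous := (continuous_regressionRate x₀ κ).lowerSemicontinuous
  lower_bound A _ := by
    rw [EReal.neg_le]
    refine le_iInf₂ fun x hx => ?_
    rw [EReal.neg_le, coe_ofReal_half_log, ← EReal.coe_neg, ← EReal.ge_of_forall_gt_iff_ge]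
    intro z hz
    have hz' := EReal.coe_lt_coe_iff.1 hz
    obtain ⟨δ, hδ, hball⟩ := Metric.isOpen_iff.1 isOpen_interior x hx
    refine le_liminf_of_le (by isBoundedDefault) ?_
    filter_upwards [lower ((x - x₀) / κ)
      (-(1 / 2 * Real.log (1 + ((x - x₀) / κ) ^ 2)) - z) δ (by linarith) hδ,
      eventually_gt_atTop 0] with n hn hn0
    have hxc : x₀ + κ * ((x - x₀) / κ) = x := by field_simp; ring
    rw [hxc] at hn
    have h1 := le_inv_mul_log hn0 (hn.trans (measure_mono (t := {ω | M n ω ∈ A}) fun ω hω =>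
      interior_subset (s := A) (hball hω)))
    convert h1 using 2
    ring
  upper_bound A _ := by
    rw [← EReal.le_of_forall_lt_iff_le]
    intro z hz
    rw [EReal.neg_lt_comm, ← EReal.coe_neg] at hz
    -- A real level strictly between `-z` and the infimum, which may be `⊤`; the gap `γ + z` absorbs
    -- the errors below.
    obtain ⟨γ, hzγ, hγ⟩ := EReal.lt_iff_exists_real_btwn.1 hz
    have hzγ' := EReal.coe_lt_coe_iff.1 hzγ
    refine limsup_le_of_le (by isBoundedDefault) ?_
    rcases le_or_gt 0 z with h0 | h0
    · filter_upwards [eventually_gt_atTop 0] with n hn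
      refine (inv_mul_log_le hn (g := 0) ?_).trans (by simpa using h0)
      simpa using prob_le_one
    · have hγ0 : 0 < γ := by linarith
      -- The level at which the rate equals `γ`. The set `{I ≤ γ}` is the interval of radius `κ c`
      -- about `x₀`, so `A` lies in the two half lines beyond it.
      set c := √(Real.exp (2 * γ) - 1) with hc
      have hexp : 0 < Real.exp (2 * γ) - 1 := by
        have : 1 < Real.exp (2 * γ) := Real.one_lt_exp_iff.2 (by linarith)
        linarith
      have hc0 : 0 < c := Real.sqrt_pos.2 hexp
      have hcγ : 1 / 2 * Real.log (1 + c ^ 2) = γ := by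
        rw [hc, Real.sq_sqrt hexp.le, add_sub_cancel, Real.log_exp]
        ring
      have hsub : ∀ n, {ω | M n ω ∈ A} ⊆ {ω | 0 ≤ c * (M n ω - (x₀ + κ * c))} ∪
          {ω | 0 ≤ -c * (M n ω - (x₀ + κ * -c))} := by
        intro n ω hω
        have h1 : (γ : EReal) < ((1 / 2 * Real.log (1 + ((M n ω - x₀) / κ) ^ 2) : ℝ) : EReal) := by
          rw [← coe_ofReal_half_log]
          exact hγ.trans_le (iInf₂_le (M n ω) (subset_closure hω))
        have h2 := EReal.coe_lt_coe_iff.1 h1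
        have h3 : c < |(M n ω - x₀) / κ| := by
          by_contra h3
          exact absurd ((half_log_one_add_sq_le_iff hγ0.le).2 (not_lt.1 h3)) (not_le.2 h2)
        rw [abs_div, abs_of_pos hκ, lt_div_iff₀ hκ, lt_abs] at h3
        rcases h3 with h3 | h3
        · exact Or.inl (mul_nonneg hc0.le (by linarith))
        · refine Or.inr ?_
          change 0 ≤ -c * (M n ω - (x₀ + κ * -c))
          rw [neg_mul, ← mul_neg]
          exact mul_nonneg hc0.le (by linarith)
      have hε : 0 < (γ + z) / 2 := by linarith
      -- Half of the gap is the `ε` of the half-line bounds, the other half pays for the factor `2`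
      -- of the union bound.
      obtain ⟨N, hN⟩ := exists_nat_ge (Real.log 2 / ((γ + z) / 2))
      filter_upwards [upper c ((γ + z) / 2) hε, upper (-c) ((γ + z) / 2) hε,
        eventually_gt_atTop 0, eventually_ge_atTop N] with n h1 h2 hn hnN
      rw [neg_sq] at h2
      rw [hcγ] at h1 h2
      refine (inv_mul_log_le hn (g := -z) ?_).trans (by simp)
      refine (measure_mono (hsub n)).trans ((measure_union_le _ _).trans ?_)
      refine (add_le_add h1 h2).trans ?_
      rw [← ENNReal.ofReal_add (Real.exp_pos _).le (Real.exp_pos _).le, ← two_mul]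
      refine ENNReal.ofReal_le_ofReal ?_
      have h3 : (2 : ℝ) = Real.exp (Real.log 2) := (Real.exp_log (by norm_num)).symm
      have h4 : Real.log 2 ≤ n * ((γ + z) / 2) := by
        rw [div_le_iff₀ hε] at hN
        exact hN.trans (by gcongr)
      calc 2 * Real.exp (-n * (γ - (γ + z) / 2))
          = Real.exp (Real.log 2 + -n * (γ - (γ + z) / 2)) := by rw [Real.exp_add, ← h3]
        _ ≤ _ := by
          rw [Real.exp_le_exp]
          linarith

/-! ### Scaled Brownian increments -/

/-- The point `i / n` of the unit interval. -/
noncomputable def unitGrid (n : ℕ) (i : Fin (n + 1)) : Icc (0 : ℝ) 1 :=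
  ⟨(i : ℝ) / n, by positivity, div_le_one_of_le₀ (by exact_mod_cast i.is_le) (by positivity)⟩

lemma monotone_unitGrid (n : ℕ) : Monotone (unitGrid n) := by
  intro i j hij
  change (i : ℝ) / n ≤ (j : ℝ) / n
  have : (i : ℝ) ≤ j := by exact_mod_cast hij
  gcongr

lemma gridIncrement_eq_unitGrid {Ω : Type*} (Z : ℝ → Ω → ℝ) (n : ℕ) (i : Fin n) (ω : Ω) :
    gridIncrement Z n (i + 1) ω =
      Z (unitGrid n i.succ) ω - Z (unitGrid n i.castSucc) ω := by
  simp [gridIncrement, unitGrid]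

lemma IsStdBrownianOnUnit.hasLaw_gridIncrement {Ω : Type*} [MeasurableSpace Ω] {P : Measure Ω}
    {B : ℝ → Ω → ℝ} (hB : IsStdBrownianOnUnit P B) (n : ℕ) (i : Fin n) :
    HasLaw (fun ω => √n * gridIncrement B n (i + 1) ω) (gaussianReal 0 1) P := by
  have hn : (0 : ℝ) < n := by exact_mod_cast i.pos
  have h1 := hB.law_increment (unitGrid n i.castSucc) (unitGrid n i.succ)
    (unitGrid n i.castSucc).2.1 (monotone_unitGrid n (Fin.castSucc_le_succ i))
    (unitGrid n i.succ).2.2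
  have h2 := gaussianReal_const_mul h1 (√n)
  simp_rw [gridIncrement_eq_unitGrid]
  convert h2 using 2
  · simp
  · ext
    simp only [unitGrid, Fin.val_succ, Fin.val_castSucc, NNReal.coe_mul, NNReal.coe_one, NNReal.coe_mk]
    have : ((i + 1 : ℕ) : ℝ) / n - (i : ℝ) / n = 1 / n := by push_cast; ring
    rw [this, Real.coe_toNNReal _ (by positivity), Real.sq_sqrt hn.le, mul_one_div_cancel hn.ne']

lemma IsStdBrownianOnUnit.iIndepFun_gridIncrement {Ω : Type*} [MeasurableSpace Ω] {P : Measure Ω}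
    {B : ℝ → Ω → ℝ} (hB : IsStdBrownianOnUnit P B) (n : ℕ) :
    iIndepFun (fun (i : Fin n) ω => √n * gridIncrement B n (i + 1) ω) P := by
  have h := (hB.indep_increments n (unitGrid n) (monotone_unitGrid n)).comp
    (fun _ x => √n * x) (fun _ => by fun_prop)
  simp_rw [gridIncrement_eq_unitGrid]
  exact h

lemma hasQuadraticLaplace_gridIncrement {Ω : Type*} [MeasurableSpace Ω] {P : Measure Ω}
    [IsProbabilityMeasure P] {B W : ℝ → Ω → ℝ} (hB : IsStdBrownianOnUnit P B)
    (hW : IsStdBrownianOnUnit P W)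
    (hBW : IndepFun (fun ω (t : Icc (0 : ℝ) 1) => B t ω) (fun ω (t : Icc (0 : ℝ) 1) => W t ω) P)
    (n : ℕ) :
    HasQuadraticLaplace P (fun (i : Fin n) ω => √n * gridIncrement B n (i + 1) ω)
      (fun (i : Fin n) ω => √n * gridIncrement W n (i + 1) ω) := by
  refine .of_indepFun (hB.hasLaw_gridIncrement n) (hW.hasLaw_gridIncrement n)
    (hB.iIndepFun_gridIncrement n) (hW.iIndepFun_gridIncrement n) ?_
  have hφ : Measurable fun (p : Icc (0 : ℝ) 1 → ℝ) (i : Fin n) =>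
      √n * (p (unitGrid n i.succ) - p (unitGrid n i.castSucc)) := by fun_prop
  simp_rw [gridIncrement_eq_unitGrid]
  exact hBW.comp hφ hφ

/-- The scaled increments of a correlated pair, expressed through pairs of independent standard
normal random variables, with either coordinate taken as the regressor. -/
lemma IsCorrelatedBrownianPair.exists_gridIncrement_eq {Ω : Type*} [MeasurableSpace Ω]
    {P : Measure Ω} [IsProbabilityMeasure P] {ρ : ℝ} (hρ : ρ ∈ Ioo (-1 : ℝ) 1)
    {B : Fin 2 → ℝ → Ω → ℝ} (hB : IsCorrelatedBrownianPair P ρ B) {ℓ ι : Fin 2} (hℓι : ℓ ≠ ι)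
    (n : ℕ) :
    ∃ ξ η : Fin n → Ω → ℝ, HasQuadraticLaplace P ξ η ∧ ∀ᵐ ω ∂P, ∀ i : Fin n,
      √n * gridIncrement (B ℓ) n (i + 1) ω = ξ i ω ∧
      √n * gridIncrement (B ι) n (i + 1) ω = ρ * ξ i ω + √(1 - ρ ^ 2) * η i ω := by
  obtain ⟨hB0, W, hW, hind, hB1⟩ := hB
  have hlap := hasQuadraticLaplace_gridIncrement hB0 hW hind n
  have hr : √(1 - ρ ^ 2) ^ 2 = 1 - ρ ^ 2 :=
    Real.sq_sqrt (by nlinarith [mul_pos (sub_pos.2 hρ.1) (sub_pos.2 hρ.2)])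
  have hinc : ∀ᵐ ω ∂P, ∀ i : Fin n, gridIncrement (B 1) n (i + 1) ω =
      ρ * gridIncrement (B 0) n (i + 1) ω + √(1 - ρ ^ 2) * gridIncrement W n (i + 1) ω := by
    filter_upwards [hB1] with ω hω i
    simp_rw [gridIncrement_eq_unitGrid]
    rw [hω _ (unitGrid n i.succ).2, hω _ (unitGrid n i.castSucc).2]
    ring
  by_cases h0 : ℓ = 0
  · have h1 : ι = 1 := by omega
    subst h0 h1
    refine ⟨_, _, hlap, ?_⟩
    filter_upwards [hinc] with ω hω i
    refine ⟨rfl, ?_⟩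
    rw [hω i]
    ring
  · have h1 : ℓ = 1 := by omega
    have h2 : ι = 0 := by omega
    subst h1 h2
    -- The regressor `ρ B 0 + √(1 - ρ²) W` becomes the first coordinate of the reflected pair;
    -- reflecting again recovers `B 0`, because a reflection is its own inverse.
    refine ⟨_, _, hlap.reflect (p := ρ) (q := √(1 - ρ ^ 2)) (by rw [hr]; ring), ?_⟩
    filter_upwards [hinc] with ω hω i
    constructor
    · rw [hω i]
      ring
    · linear_combination (-(√n * gridIncrement (B 0) n (i + 1) ω)) * hr

/-! ### Contribution of the bounded drift -/

/-- By Fubini, an essential bound on the product is, for almost every `ω`, an essential bound in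
time with the same constant, so the integrated drift is Lipschitz uniformly in `ω`. -/
lemma IsBoundedDrift.exists_abs_integral_le {Ω : Type*} [MeasurableSpace Ω] {P : Measure Ω}
    [IsProbabilityMeasure P] {b : ℝ → Ω → ℝ} (hb : IsBoundedDrift P b) :
    ∃ K : ℝ, ∀ᵐ ω ∂P, IntervalIntegrable (fun s => b s ω) volume 0 1 ∧
      ∀ s ∈ Icc (0 : ℝ) 1, ∀ t ∈ Icc (0 : ℝ) 1, |∫ u in s..t, b u ω| ≤ K * |t - s| := by
  obtain ⟨hbm, hbt⟩ := hb
  set K : ℝ≥0∞ := eLpNormEssSup (fun p : ℝ × Ω => b p.1 p.2)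
    ((volume.restrict (Icc (0 : ℝ) 1)).prod P) with hK
  have hKt : K < ∞ := by rwa [eLpNorm_exponent_top] at hbt
  have h1 : ∀ᵐ p ∂((volume.restrict (Icc (0 : ℝ) 1)).prod P), ‖b p.1 p.2‖ ≤ K.toReal := by
    filter_upwards [ae_le_eLpNormEssSup (f := fun p : ℝ × Ω => b p.1 p.2)
      (μ := (volume.restrict (Icc (0 : ℝ) 1)).prod P)] with p hp
    rw [← toReal_enorm]
    exact ENNReal.toReal_mono hKt.ne hp
  have h2 : ∀ᵐ ω ∂P, ∀ᵐ s ∂(volume.restrict (Icc (0 : ℝ) 1)), ‖b s ω‖ ≤ K.toReal := by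
    have h3 := (Measure.measurePreserving_swap (μ := P)
      (ν := volume.restrict (Icc (0 : ℝ) 1))).quasiMeasurePreserving.ae h1
    exact Measure.ae_ae_of_ae_prod h3
  have h4 : ∀ᵐ ω ∂P, AEStronglyMeasurable (fun s => b s ω) (volume.restrict (Icc (0 : ℝ) 1)) :=
    hbm.prod_swap.prodMk_left
  refine ⟨K.toReal, ?_⟩
  filter_upwards [h2, h4] with ω hω hmeas
  refine ⟨?_, fun s hs t ht => ?_⟩
  · rw [intervalIntegrable_iff_integrableOn_Icc_of_le zero_le_one]
    exact Integrable.of_bound hmeas _ hω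
  · have hae := (ae_restrict_iff' measurableSet_Icc).1 hω
    exact intervalIntegral.norm_integral_le_of_norm_le_const_ae (by
      filter_upwards [hae] with u hu hmem
      exact hu (uIoc_subset_uIcc.trans (uIcc_subset_Icc hs ht) hmem))

lemma IsBoundedDrift.aemeasurable_integral {Ω : Type*} [MeasurableSpace Ω] {P : Measure Ω}
    [IsProbabilityMeasure P] {b : ℝ → Ω → ℝ} (hb : IsBoundedDrift P b) {s t : ℝ}
    (hs : s ∈ Icc (0 : ℝ) 1) (ht : t ∈ Icc (0 : ℝ) 1) (hst : s ≤ t) :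
    AEMeasurable (fun ω => ∫ u in s..t, b u ω) P := by
  simp_rw [intervalIntegral.integral_of_le hst]
  have h1 : volume.restrict (Ioc s t) ≪ volume.restrict (Icc (0 : ℝ) 1) :=
    (Measure.restrict_mono (Ioc_subset_Icc_self.trans (Icc_subset_Icc hs.1 ht.2))
      le_rfl).absolutelyContinuous
  have h2 : AEStronglyMeasurable (fun p : ℝ × Ω => b p.1 p.2)
      ((volume.restrict (Ioc s t)).prod P) :=
    hb.1.mono_ac (h1.prod Measure.AbsolutelyContinuous.rfl)
  exact h2.prod_swap.integral_prod_right'.aemeasurable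

lemma gridIncrement_ito {Ω : Type*} [MeasurableSpace Ω] {P : Measure Ω}
    [IsProbabilityMeasure P] {σ : ℝ} {B b X : ℝ → Ω → ℝ} (hb : IsBoundedDrift P b)
    (hX : IsConstVolItoProcess P σ B b X) :
    ∀ᵐ ω ∂P, ∀ (n : ℕ) (i : Fin n), gridIncrement X n (i + 1) ω =
      σ * gridIncrement B n (i + 1) ω +
        ∫ u in (unitGrid n i.castSucc : ℝ)..(unitGrid n i.succ), b u ω := by
  obtain ⟨K, hK⟩ := hb.exists_abs_integral_le
  filter_upwards [hK, hX] with ω hω hXω n i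
  simp_rw [gridIncrement_eq_unitGrid]
  rw [hXω _ (unitGrid n i.succ).2, hXω _ (unitGrid n i.castSucc).2]
  have hint : ∀ t ∈ Icc (0 : ℝ) 1, IntervalIntegrable (fun s => b s ω) volume 0 t := fun t ht =>
    hω.1.mono_set (uIcc_subset_uIcc left_mem_uIcc (by rwa [uIcc_of_le zero_le_one]))
  rw [← intervalIntegral.integral_interval_sub_left (hint _ (unitGrid n i.succ).2)
    (hint _ (unitGrid n i.castSucc).2)]
  ring

lemma aemeasurable_gridIncrement_ito {Ω : Type*} [MeasurableSpace Ω] {P : Measure Ω}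
    [IsProbabilityMeasure P] {σ : ℝ} {B b X : ℝ → Ω → ℝ} (hb : IsBoundedDrift P b)
    (hX : IsConstVolItoProcess P σ B b X) {n : ℕ} {i : Fin n}
    (hB : AEMeasurable (gridIncrement B n (i + 1)) P) :
    AEMeasurable (gridIncrement X n (i + 1)) P := by
  refine ((hB.const_mul σ).add (hb.aemeasurable_integral (unitGrid n i.castSucc).2
    (unitGrid n i.succ).2 (monotone_unitGrid n (Fin.castSucc_le_succ i)))).congr ?_
  filter_upwards [gridIncrement_ito hb hX] with ω hω
  exact (hω n i).symm

/-- A drift increment is `O(1/n)`; scaling by `√n` and squaring leaves `O(1/n)`, so that the sum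
over the `n` increments is bounded. -/
lemma sq_scaled_drift_le {Ω : Type*} [MeasurableSpace Ω] {P : Measure Ω}
    [IsProbabilityMeasure P] {σ : ℝ} (hσ : 0 < σ) {B b X : ℝ → Ω → ℝ} (hb : IsBoundedDrift P b)
    (hX : IsConstVolItoProcess P σ B b X) :
    ∃ K : ℝ, ∀ᵐ ω ∂P, ∀ (n : ℕ) (i : Fin n),
      (√n * gridIncrement X n (i + 1) ω / σ - √n * gridIncrement B n (i + 1) ω) ^ 2 ≤ K / n := by
  obtain ⟨K, hK⟩ := hb.exists_abs_integral_le
  refine ⟨(K / σ) ^ 2, ?_⟩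
  filter_upwards [hK, gridIncrement_ito hb hX] with ω hω hinc n i
  have hn : (0 : ℝ) < n := by exact_mod_cast i.pos
  have h1 := hω.2 _ (unitGrid n i.castSucc).2 _ (unitGrid n i.succ).2
  have h2 : (unitGrid n i.succ : ℝ) - unitGrid n i.castSucc = 1 / n := by
    simp [unitGrid]
    ring
  rw [h2, abs_of_pos (by positivity : (0 : ℝ) < 1 / n)] at h1
  rw [hinc n i]
  set I := ∫ u in (unitGrid n i.castSucc : ℝ)..(unitGrid n i.succ), b u ω
  have h3 : √n * (σ * gridIncrement B n (i + 1) ω + I) / σ - √n * gridIncrement B n (i + 1) ω =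
      √n * I / σ := by
    field_simp
    ring
  have h4 : I ^ 2 ≤ (K * (1 / n)) ^ 2 := sq_le_sq' (by linarith [neg_abs_le I]) ((le_abs_self I).trans h1)
  rw [h3, div_pow, mul_pow, Real.sq_sqrt hn.le]
  calc n * I ^ 2 / σ ^ 2 ≤ n * (K * (1 / n)) ^ 2 / σ ^ 2 := by gcongr
    _ = (K / σ) ^ 2 / n := by field_simp

/-! ### Normalisation of the regression coefficient and conclusion -/

lemma sum_Icc_one_eq_sum_fin (n : ℕ) (f : ℕ → ℝ) :
    ∑ k ∈ Finset.Icc 1 ⌊(n : ℝ) * 1⌋₊, f k = ∑ i : Fin n, f (i + 1) := by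
  rw [mul_one, Nat.floor_natCast, Fin.sum_univ_eq_sum_range (fun k => f (k + 1)),
    Finset.range_eq_Ico, Finset.sum_Ico_add' f 0 n 1]
  rfl

lemma realizedRegression_one_eq {Ω : Type*} (X : Fin 2 → ℝ → Ω → ℝ) {ℓ ι : Fin 2} (hℓι : ℓ ≠ ι)
    (n : ℕ) (ω : Ω) :
    realizedRegression X ℓ n 1 ω =
      (∑ i : Fin n, gridIncrement (X ℓ) n (i + 1) ω * gridIncrement (X ι) n (i + 1) ω) /
        ∑ i : Fin n, gridIncrement (X ℓ) n (i + 1) ω ^ 2 := by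
  unfold realizedRegression realizedCovariance realizedVariance
  rw [sum_Icc_one_eq_sum_fin n fun k => gridIncrement (X ℓ) n k ω ^ 2,
    sum_Icc_one_eq_sum_fin n fun k => gridIncrement (X 0) n k ω * gridIncrement (X 1) n k ω]
  by_cases h0 : ℓ = 0
  · have h1 : ι = 1 := by omega
    rw [h0, h1]
  · have h1 : ℓ = 1 := by omega
    have h2 : ι = 0 := by omega
    rw [h1, h2]
    simp_rw [mul_comm (gridIncrement (X 0) n _ ω)]

/-- Normalisation of an empirical regression coefficient, valid also when all the regressors
vanish. -/
lemma sum_mul_sub_eq_regression_sub {n : ℕ} (A D : Fin n → ℝ) {p q r : ℝ} (hp : 0 < p) (hq : 0 < q)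
    (hr : 0 < r) (s ρ c : ℝ) :
    ∑ i, s * A i / p * ((s * D i / q - ρ * (s * A i / p)) / r - c * (s * A i / p)) =
      ((∑ i, A i * D i) / (∑ i, A i ^ 2) - (ρ * q / p + q * r / p * c)) / (q * r / p) *
        ∑ i, (s * A i / p) ^ 2 := by
  have h1 : ∑ i, s * A i / p * ((s * D i / q - ρ * (s * A i / p)) / r - c * (s * A i / p)) =
      s ^ 2 / (p * q * r) * (∑ i, A i * D i) -
        s ^ 2 / (p * q * r) * (ρ * q / p + q * r / p * c) * ∑ i, A i ^ 2 := by
    rw [Finset.mul_sum, Finset.mul_sum, ← Finset.sum_sub_distrib]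
    refine Finset.sum_congr rfl fun i _ => ?_
    field_simp
    ring
  have h2 : ∑ i, (s * A i / p) ^ 2 = s ^ 2 / p ^ 2 * ∑ i, A i ^ 2 := by
    rw [Finset.mul_sum]
    refine Finset.sum_congr rfl fun i _ => ?_
    field_simp
  -- If the denominator vanishes, then so do all `A i` and the numerator: the convention `x / 0 = 0`
  -- does no harm.
  have h3 : ∑ i, A i * D i = (∑ i, A i * D i) / (∑ i, A i ^ 2) * ∑ i, A i ^ 2 := by
    by_cases h : ∑ i, A i ^ 2 = 0
    · have hA : ∀ i, A i = 0 := fun i => by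
        have := (Finset.sum_eq_zero_iff_of_nonneg fun i _ => sq_nonneg (A i)).1 h i
          (Finset.mem_univ i)
        exact pow_eq_zero_iff (two_ne_zero) |>.1 this
      simp [hA]
    · rw [div_mul_cancel₀ _ h]
  rw [h1, h2]
  generalize (∑ i, A i * D i) / (∑ i, A i ^ 2) = m at h3 ⊢
  rw [h3]
  field_simp

theorem mainTheorem11 {Ω : Type*} [MeasurableSpace Ω] (P : Measure Ω) [IsProbabilityMeasure P]
    (σ : Fin 2 → ℝ) (hσ : ∀ i, 0 < σ i) (ρ : ℝ) (hρ : ρ ∈ Ioo (-1 : ℝ) 1)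
    (B b X : Fin 2 → ℝ → Ω → ℝ)
    (hB : IsCorrelatedBrownianPair P ρ B)
    (hb : ∀ i, IsBoundedDrift P (b i))
    (hX : ∀ i, IsConstVolItoProcess P (σ i) (B i) (b i) (X i))
    (ℓ ι : Fin 2) (hℓι : ℓ ≠ ι) :
    SatisfiesLDP P (fun n ω => realizedRegression X ℓ n 1 ω) (fun n => (n : ℝ))
        (fun u : ℝ => ENNReal.ofReal
          (1 / 2 * Real.log (1 + (σ ℓ * u - ρ * σ ι) ^ 2 / (σ ι ^ 2 * (1 - ρ ^ 2))))) ∧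
      IsGoodRateFunction
        (fun u : ℝ => ENNReal.ofReal
          (1 / 2 * Real.log (1 + (σ ℓ * u - ρ * σ ι) ^ 2 / (σ ι ^ 2 * (1 - ρ ^ 2))))) := by
  have hρ2 : 0 < 1 - ρ ^ 2 := by nlinarith [mul_pos (sub_pos.2 hρ.1) (sub_pos.2 hρ.2)]
  set r := √(1 - ρ ^ 2) with hr
  have hr0 : 0 < r := Real.sqrt_pos.2 hρ2
  have hr2 : r ^ 2 = 1 - ρ ^ 2 := Real.sq_sqrt hρ2.le
  have hp := hσ ℓ
  have hq := hσ ι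
  have hκ : 0 < σ ι * r / σ ℓ := by positivity
  -- The level `c` for the normalised pair corresponds to `u = ρ σ_ι / σ_ℓ + (σ_ι r / σ_ℓ) c` for
  -- the original one.
  have hrate : (fun u : ℝ => ENNReal.ofReal
      (1 / 2 * Real.log (1 + (σ ℓ * u - ρ * σ ι) ^ 2 / (σ ι ^ 2 * (1 - ρ ^ 2))))) =
      fun u : ℝ => ENNReal.ofReal
        (1 / 2 * Real.log (1 + ((u - ρ * σ ι / σ ℓ) / (σ ι * r / σ ℓ)) ^ 2)) := by
    funext u
    congr 4
    rw [← hr2]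
    field_simp
  rw [hrate]
  refine ⟨?_, isGoodRateFunction_regressionRate _ hκ⟩
  choose ξ η hlap hξη using fun n => hB.exists_gridIncrement_eq hρ hℓι n
  obtain ⟨K₁, hK₁⟩ := sq_scaled_drift_le hp (hb ℓ) (hX ℓ)
  obtain ⟨K₂, hK₂⟩ := sq_scaled_drift_le hq (hb ι) (hX ι)
  -- The error of `d` is `(y - ρ x) / r`, where `x`, `y` are the drift errors of the two
  -- coordinates, and `(y - ρ x)² ≤ 2 (y² + ρ² x²)`.
  set K : ℝ := K₁ + 2 * (K₂ + ρ ^ 2 * K₁) / r ^ 2 with hK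
  set a : ∀ n : ℕ, Fin n → Ω → ℝ := fun n i ω => √n * gridIncrement (X ℓ) n (i + 1) ω / σ ℓ with ha
  set d : ∀ n : ℕ, Fin n → Ω → ℝ := fun n i ω =>
    (√n * gridIncrement (X ι) n (i + 1) ω / σ ι - ρ * a n i ω) / r with hd
  have herr : ∀ n, 0 < n → ∀ᵐ ω ∂P,
      ∑ i, ((a n i ω - ξ n i ω) ^ 2 + (d n i ω - η n i ω) ^ 2) ≤ K := by
    intro n hn
    have hn' : (0 : ℝ) < n := by exact_mod_cast hn
    filter_upwards [hK₁, hK₂, hξη n] with ω h1 h2 h3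
    have h4 : ∀ i, (a n i ω - ξ n i ω) ^ 2 + (d n i ω - η n i ω) ^ 2 ≤ K / n := by
      intro i
      have e1 := h1 n i
      have e2 := h2 n i
      rw [(h3 i).1] at e1
      rw [(h3 i).2] at e2
      set x := √n * gridIncrement (X ℓ) n (i + 1) ω / σ ℓ - ξ n i ω with hx
      set y := √n * gridIncrement (X ι) n (i + 1) ω / σ ι - (ρ * ξ n i ω + r * η n i ω) with hy
      have e3 : d n i ω - η n i ω = (y - ρ * x) / r := by
        simp only [hd, ha, hx, hy]
        field_simp
        ring
      rw [e3, div_pow]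
      have e5 : (y - ρ * x) ^ 2 ≤ 2 * (K₂ / n + ρ ^ 2 * (K₁ / n)) := by
        nlinarith [sq_nonneg (y + ρ * x), mul_le_mul_of_nonneg_left e1 (sq_nonneg ρ)]
      calc x ^ 2 + (y - ρ * x) ^ 2 / r ^ 2
          ≤ K₁ / n + 2 * (K₂ / n + ρ ^ 2 * (K₁ / n)) / r ^ 2 := by gcongr
        _ = K / n := by rw [hK]; field_simp
    refine (Finset.sum_le_sum fun i _ => h4 i).trans_eq ?_
    simp
    field_simp
  -- Turns events about the regression coefficient into events about the sum to which the Gaussian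
  -- bounds apply.
  have hid : ∀ n ω c, ∑ i, a n i ω * (d n i ω - c * a n i ω) =
      (realizedRegression X ℓ n 1 ω - (ρ * σ ι / σ ℓ + σ ι * r / σ ℓ * c)) / (σ ι * r / σ ℓ) *
        ∑ i, a n i ω ^ 2 := by
    intro n ω c
    rw [realizedRegression_one_eq X hℓι]
    exact sum_mul_sub_eq_regression_sub _ _ hp hq hr0 _ _ _
  refine SatisfiesLDP.of_halfLine_of_near (fun n => ?_) _ hκ ?_ ?_
  · have hBℓ : ∀ i : Fin n, AEMeasurable (gridIncrement (X ℓ) n (i + 1)) P := fun i => by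
      have hn : (0 : ℝ) < n := by exact_mod_cast i.pos
      refine aemeasurable_gridIncrement_ito (hb ℓ) (hX ℓ)
        ((((hlap n).1 i).const_mul (√n)⁻¹).congr ?_)
      filter_upwards [hξη n] with ω h
      rw [← (h i).1]
      field_simp
    have hBι : ∀ i : Fin n, AEMeasurable (gridIncrement (X ι) n (i + 1)) P := fun i => by
      have hn : (0 : ℝ) < n := by exact_mod_cast i.pos
      refine aemeasurable_gridIncrement_ito (hb ι) (hX ι)
        (((((hlap n).1 i).const_mul ρ).add (((hlap n).2 i).const_mul r)).const_mul (√n)⁻¹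
          |>.congr ?_)
      filter_upwards [hξη n] with ω h
      simp only [Pi.add_apply]
      rw [← (h i).2]
      field_simp
    simp_rw [realizedRegression_one_eq X hℓι]
    exact (Finset.aemeasurable_fun_sum _ fun i _ => (hBℓ i).mul (hBι i)).div
      (Finset.aemeasurable_fun_sum _ fun i _ => (hBℓ i).pow_const 2)
  · intro c ε hε
    obtain ⟨N, hN⟩ := measure_regression_ge_le c K hε
    filter_upwards [eventually_ge_atTop N, eventually_gt_atTop 0] with n hn hn0
    refine (measure_mono fun ω hω => ?_).trans (hN n hn (hlap n) (herr n hn0))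
    change 0 ≤ c * ∑ i, a n i ω * (d n i ω - c * a n i ω)
    rw [hid, ← mul_assoc, ← mul_div_assoc]
    have : 0 ≤ ∑ i, a n i ω ^ 2 := Finset.sum_nonneg fun i _ => sq_nonneg _
    exact mul_nonneg (div_nonneg hω hκ.le) this
  · intro c ε δ hε hδ
    obtain ⟨N, hN⟩ := le_measure_regression_near c K hε (div_pos hδ hκ)
    filter_upwards [eventually_ge_atTop N, eventually_gt_atTop 0] with n hn hn0
    refine (hN n hn (hlap n) (herr n hn0)).trans (measure_mono fun ω hω => ?_)
    obtain ⟨h1, h2⟩ := hω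
    rw [hid, abs_mul, abs_of_pos h1, abs_div, abs_of_pos hκ] at h2
    exact (div_lt_div_iff_of_pos_right hκ).1 (lt_of_mul_lt_mul_right h2 h1.le)
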